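/- Let finitely many obstacles in $\mathbb{R}^2$ be given, each bounded by a simple polygon, with faces (closed edges) $k\in\mathcal F$, outward unit normals $\hat n_k$ and vertices $c_k$. (The obstacles are understood to be already enlarged by the size of the robot, so the robot is a point.) A trajectory on $[t^0,t^f]$ is a triple $(p,v,u)$ with $\dot p=v$, $\dot v=u$ (in integrated form) and $u\in L^2$; its energy is $J(u)=\frac12\int_{t^0}^{t^f}\|u\|^2\,dt$. It is feasible if it has the prescribed states $(p,v)$ at $t^0$ and $t^f$ and $p(t)$ is never in the interior of an obstacle. Let $(p,v,u)$ be a feasible trajectory and $t^0\le a<t_i<b\le t^f$. Suppose that during $(a,b)$ the robot meets the obstacles only at the instant $t_i$, in a vertex $c_j$, and that $(a,t_i)$ and $(t_i,b)$ are unconstrained arcs ($\ddot u=0$). If $$p(t_i)=c_j,\quad v(t_i^-)=v(t_i^+),\quad u(t_i^-)=u(t_i^+),\quad \big(\dot u(t_i^-)-\dot u(t_i^+)\big)\cdot v(t_i)=0,$$ then the trajectory is optimal at the junction $t_i$, with the contact treated as an interior-point constraint, in the following sense. (i) It satisfies the first-order optimality conditions on both arcs and at the junction: with $H=\frac12\|u\|^2+v\cdot\lambda^p+u\cdot\lambda^v-\sum_{k\in\mathcal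 F}\mu_k\,u\cdot\hat n_k$ there are costates $\lambda^p,\lambda^v$, multipliers $\mu_k\ge 0$ that vanish whenever $p(t)$ is not on face $k$, and a constant vector $\pi$ such that on both arcs $\dot\lambda^p=-\partial H/\partial p$, $\dot\lambda^v=-\partial H/\partial v$ and $u(t)$ minimizes $H$ over all control values, while at $t_i$ one has $\lambda^-=\lambda^++(\partial N/\partial x)^T\pi$ for $\lambda=(\lambda^p,\lambda^v)$, $x=(p,v)$, $N(x)=p-c_j$, and $H^-=H^+$. (ii) $J(u)$ is the least energy of all trajectories on $[t^0,t^f]$ that have the same state $(p,v)$ as the given one at all times outside $(a,b)$ and are at $c_j$ at time $t_i$, whether or not they avoid the obstacles; in particular it is the least energy of the feasible ones among them. (iii) Let $W(s)$ be the infimum of the energies of all trajectories that have the same state as the given one outside $(a,b)$ and are at $c_j$ at time $s$. Then $W$ is differentiable at $s=t_i$ and $W'(t_i)=0$, that is, the energy is stationary with respect to the contact time. -/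

import Mathlib

open Set Filter Topology MeasureTheory

/-- The plane `ℝ²` with its Euclidean norm and inner product. -/
abbrev Plane : Type := EuclideanSpace ℝ (Fin 2)

/-! ### The environment: finitely many simple polygons -/

/-- `N` polygons; polygon `l` has `n l` vertices, listed in cyclic order. Vertex `i` and the face
that joins vertex `i` to the next vertex carry the same index, so that there are as many faces as
vertices. Each polygon is simple: its vertices are distinct, and two different faces of it meet at
most in a common end point. -/
structure Environment where
  N : ℕ
  n : Fin N → ℕ
  three_le : ∀ l, 3 ≤ n l
  vertex : (l : Fin N) → Fin (n l) → Plane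
  vertex_injective : ∀ l, Function.Injective (vertex l)
  simple : ∀ l (i j : Fin (n l)), i ≠ j →
    segment ℝ (vertex l i) (vertex l (finRotate (n l) i)) ∩
      segment ℝ (vertex l j) (vertex l (finRotate (n l) j)) ⊆
    {vertex l i, vertex l (finRotate (n l) i)} ∩ {vertex l j, vertex l (finRotate (n l) j)}

namespace Environment

/-- The common index set of the faces and of the vertices. -/
abbrev Face (O : Environment) : Type := (l : Fin O.N) × Fin (O.n l)

variable (O : Environment)

/-- The vertex with index `k`; it is the first end point of face `k`. -/
def corner (k : O.Face) : Plane := O.vertex k.1 k.2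

/-- The second end point of face `k`. -/
def nextCorner (k : O.Face) : Plane := O.vertex k.1 (finRotate (O.n k.1) k.2)

/-- The face `k`, a closed segment. -/
def face (k : O.Face) : Set Plane := segment ℝ (O.corner k) (O.nextCorner k)

/-- The distance from `q` to the nearest point of face `k`. -/
noncomputable def faceDist (k : O.Face) (q : Plane) : ℝ := Metric.infDist q (O.face k)

/-- The boundary of polygon `l`, a closed polygonal curve. -/
def boundary (l : Fin O.N) : Set Plane := ⋃ i : Fin (O.n l), O.face ⟨l, i⟩

/-- The open region enclosed by the boundary of polygon `l`. -/
def inside (l : Fin O.N) : Set Plane :=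
  {q | q ∉ O.boundary l ∧ Bornology.IsBounded (connectedComponentIn (O.boundary l)ᶜ q)}

/-- The obstacle `l`: polygon `l` together with its boundary. -/
def body (l : Fin O.N) : Set Plane := O.boundary l ∪ O.inside l

/-- `m` is the unit normal of face `k` that points away from the polygon. -/
def IsOutwardNormal (k : O.Face) (m : Plane) : Prop :=
  ‖m‖ = 1 ∧ inner ℝ m (O.nextCorner k - O.corner k) = 0 ∧
    ∀ q ∈ openSegment ℝ (O.corner k) (O.nextCorner k),
      ∀ᶠ s : ℝ in 𝓝[>] 0, q + s • m ∉ O.inside k.1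

end Environment

/-! ### The optimal control problem -/

/-- `(p, v, u)` is a trajectory of the double integrator `p' = v`, `v' = u` on `[t₀, t₁]` with a
control of finite energy; the differential equations are meant in integrated form. -/
structure IsTrajectory (t₀ t₁ : ℝ) (p v u : ℝ → Plane) : Prop where
  memLp : MemLp u 2 (volume.restrict (Icc t₀ t₁))
  vel : ∀ t ∈ Icc t₀ t₁, v t = v t₀ + ∫ s in t₀..t, u s
  pos : ∀ t ∈ Icc t₀ t₁, p t = p t₀ + ∫ s in t₀..t, v s

/-- The energy `J(u)`. -/
noncomputable def energy (t₀ t₁ : ℝ) (u : ℝ → Plane) : ℝ := (1 / 2) * ∫ t in t₀..t₁, ‖u t‖ ^ 2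

/-- Feasibility of a trajectory of the (point) robot: dynamics, boundary states
`x₀ = (p(t₀), v(t₀))` and `x₁ = (p(t₁), v(t₁))`, and collision avoidance. Touching the boundary of
an obstacle is allowed. -/
structure IsFeasible (O : Environment) (t₀ t₁ : ℝ) (x₀ x₁ : Plane × Plane) (p v u : ℝ → Plane) :
    Prop where
  trajectory : IsTrajectory t₀ t₁ p v u
  initial : (p t₀, v t₀) = x₀
  final : (p t₁, v t₁) = x₁
  avoid : ∀ t ∈ Icc t₀ t₁, ∀ l, p t ∉ O.inside l

/-! ### Junctions -/

/-- Within `(a, b)` the path `p` meets the obstacles only at time `τ`, in the vertex `c_j`. -/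
def TouchesInstantaneously (O : Environment) (a b τ : ℝ) (j : O.Face) (p : ℝ → Plane) : Prop :=
  p τ = O.corner j ∧ ∀ t ∈ Ioo a b, t ≠ τ → ∀ l, p t ∉ O.body l

/-- `u` is an unconstrained arc on `(a, b)`: it is twice differentiable, with first derivative `w`
and second derivative `0`. -/
def IsUnconstrainedArc (a b : ℝ) (u w : ℝ → Plane) : Prop :=
  ∀ t ∈ Ioo a b, HasDerivAt u (w t) t ∧ HasDerivAt w 0 t

/-- The left-hand and the right-hand limit of `f` at `τ` exist and are equal. -/
def LimitsMatch {X : Type*} [TopologicalSpace X] (f : ℝ → X) (τ : ℝ) : Prop :=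
  ∃ x, Tendsto f (𝓝[<] τ) (𝓝 x) ∧ Tendsto f (𝓝[>] τ) (𝓝 x)

/-- The conditions `p(τ) = c`, `v(τ⁻) = v(τ⁺)`, `u(τ⁻) = u(τ⁺)` and
`(u'(τ⁻) - u'(τ⁺)) ⬝ v(τ) = 0`; the function `w` is the derivative of `u` off `τ`. -/
def JunctionConditions (p v u w : ℝ → Plane) (τ : ℝ) (c : Plane) : Prop :=
  p τ = c ∧ LimitsMatch v τ ∧ LimitsMatch u τ ∧
    ∃ wl wr : Plane, Tendsto w (𝓝[<] τ) (𝓝 wl) ∧ Tendsto w (𝓝[>] τ) (𝓝 wr) ∧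
      inner ℝ (wl - wr) (v τ) = 0

/-! ### The optimality conditions of the calculus of variations -/

/-- The Hamiltonian at position `_q`, velocity `y`, control `ω`, with costates `lp`, `lv` and
multipliers `μ k`; the vectors `nrm k` are the outward normals of the faces. -/
noncomputable def hamiltonian (O : Environment) (nrm : O.Face → Plane) (_q y ω lp lv : Plane)
    (μ : O.Face → ℝ) : ℝ :=
  (1 / 2) * ‖ω‖ ^ 2 + inner ℝ y lp + inner ℝ ω lv - ∑ k, μ k * inner ℝ ω (nrm k)

/-- The optimality conditions on the two arcs in `(a, τ)` and `(τ, b)` and at the junction `τ`, for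
the interior-point constraint `N(p(τ)) = 0` with `N(q) = q - c_j` and free contact time `τ`:
the Euler-Lagrange (costate) equations, the complementarity conditions for the multipliers, the
minimum principle, the jump condition for the costates with a constant multiplier `κ`
(the transposed Jacobian of `N` with respect to `(p, v)` applied to `κ`), and continuity of the
Hamiltonian (`N` does not depend on time). -/
def SatisfiesOptimalityConditions (O : Environment) (nrm : O.Face → Plane) (a τ b : ℝ)
    (j : O.Face) (p v u : ℝ → Plane) : Prop :=
  ∃ (lp lv : ℝ → Plane) (μ : ℝ → O.Face → ℝ) (κ lpl lpr lvl lvr : Plane),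
    (∀ t ∈ Ioo a τ ∪ Ioo τ b,
      HasDerivAt lp
        (-gradient (fun q => hamiltonian O nrm q (v t) (u t) (lp t) (lv t) (μ t)) (p t)) t ∧
      HasDerivAt lv
        (-gradient (fun y => hamiltonian O nrm (p t) y (u t) (lp t) (lv t) (μ t)) (v t)) t ∧
      (∀ k, 0 ≤ μ t k ∧ (0 < O.faceDist k (p t) → μ t k = 0)) ∧
      ∀ ω, hamiltonian O nrm (p t) (v t) (u t) (lp t) (lv t) (μ t) ≤
        hamiltonian O nrm (p t) (v t) ω (lp t) (lv t) (μ t)) ∧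
    Tendsto lp (𝓝[<] τ) (𝓝 lpl) ∧ Tendsto lp (𝓝[>] τ) (𝓝 lpr) ∧
    Tendsto lv (𝓝[<] τ) (𝓝 lvl) ∧ Tendsto lv (𝓝[>] τ) (𝓝 lvr) ∧
    lpl = lpr + (fderiv ℝ (fun q : Plane => q - O.corner j) (p τ)).adjoint κ ∧
    lvl = lvr + (fderiv ℝ (fun _ : Plane => p τ - O.corner j) (v τ)).adjoint κ ∧
    LimitsMatch (fun t => hamiltonian O nrm (p t) (v t) (u t) (lp t) (lv t) (μ t)) τ

/-! ### Optimality of the energy at a junction -/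

/-- `(q, y, ω)` is a trajectory on `[t₀, t₁]` which is in the same state as `(p, v)` at all times of
`[t₀, t₁]` outside `(a, b)` and which is at the point `c` at time `τ`. -/
def IsCompetitor (t₀ t₁ a b : ℝ) (p v : ℝ → Plane) (c : Plane) (τ : ℝ) (q y ω : ℝ → Plane) :
    Prop :=
  IsTrajectory t₀ t₁ q y ω ∧ (∀ t ∈ Icc t₀ t₁ \ Ioo a b, q t = p t ∧ y t = v t) ∧ q τ = c

/-- The energies of all competitors that are at the point `c` at time `τ`. -/
def contactEnergies (t₀ t₁ a b : ℝ) (p v : ℝ → Plane) (c : Plane) (τ : ℝ) : Set ℝ :=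
  {J | ∃ q y ω, IsCompetitor t₀ t₁ a b p v c τ q y ω ∧ J = energy t₀ t₁ ω}

/-- Optimality of `(p, v, u)` at a junction at time `τ` with the vertex `c_j`. -/
structure IsOptimalAtJunction (O : Environment) (nrm : O.Face → Plane) (t₀ t₁ a τ b : ℝ)
    (x₀ x₁ : Plane × Plane) (j : O.Face) (p v u : ℝ → Plane) : Prop where
  /-- The first-order optimality conditions hold. -/
  conditions : SatisfiesOptimalityConditions O nrm a τ b j p v u
  /-- The energy is minimal among all trajectories that touch the vertex at time `τ`. -/
  least : IsLeast (contactEnergies t₀ t₁ a b p v (O.corner j) τ) (energy t₀ t₁ u)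
  /-- In particular the trajectory solves the obstacle avoidance problem among the trajectories
  that touch the vertex at time `τ`. -/
  least_feasible : IsLeast {J | ∃ q y ω, IsFeasible O t₀ t₁ x₀ x₁ q y ω ∧
    IsCompetitor t₀ t₁ a b p v (O.corner j) τ q y ω ∧ J = energy t₀ t₁ ω} (energy t₀ t₁ u)
  /-- The least energy is stationary with respect to the contact time. -/
  stationary : HasDerivAt (fun s => sInf (contactEnergies t₀ t₁ a b p v (O.corner j) s)) 0 τ

/-! On each arc `u` is affine, with the common value `u₀` at `τ` and slopes `wl`, `wr`. Write a
competitor as the given trajectory plus `(ξ, η, δ)`, which vanishes in position and velocity outside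
`(a, b)`. Integrating `∫ u · δ` by parts on the two arcs leaves only `(wr - wl) · ξ(τ)`, so
`energy_add` expands the energy exactly as `J(u) + (wr - wl) · ξ(τ) + ½∫‖δ‖²`.

Contact at time `τ` means `ξ(τ) = 0`, which gives minimality at once. For contact at a nearby time
`s`, `ξ(s) = c - p(s)`. A lower bound (`energy_ge_of_isCompetitor`) and an explicit competitor
(`exists_isCompetitor`) show that the least energy is `J(u) + (wr - wl) · (c - p(s)) + O((s - τ)²)`.
As `p(s) - c = (s - τ) v(τ) + O((s - τ)²)`, the orthogonality condition removes the linear term, so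
the derivative is zero.

The first-order conditions hold with `λᵖ = u'`, `λᵛ = -u`, `μ = 0` and `π = wl - wr`. -/

/-! ### Trajectories form a vector space -/

namespace IsTrajectory

variable {t₀ t₁ : ℝ} {p v u q y ω : ℝ → Plane}

theorem intervalIntegrable_control (h : IsTrajectory t₀ t₁ p v u) {s t : ℝ}
    (hs : s ∈ Icc t₀ t₁) (ht : t ∈ Icc t₀ t₁) : IntervalIntegrable u volume s t := by
  have : IntegrableOn u (Icc t₀ t₁) := h.memLp.integrable one_le_two
  exact (this.mono_set (uIcc_subset_Icc hs ht)).intervalIntegrable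

theorem continuousOn_velocity (h : IsTrajectory t₀ t₁ p v u) : ContinuousOn v (Icc t₀ t₁) := by
  have : IntegrableOn u (Icc t₀ t₁) := h.memLp.integrable one_le_two
  exact ((continuousOn_const (c := v t₀)).add
    (intervalIntegral.continuousOn_primitive_Icc this)).congr fun t ht => by
      simp only [Pi.add_apply]
      rw [h.vel t ht, intervalIntegral.integral_of_le ht.1, integral_Icc_eq_integral_Ioc]

theorem intervalIntegrable_velocity (h : IsTrajectory t₀ t₁ p v u) {s t : ℝ}
    (hs : s ∈ Icc t₀ t₁) (ht : t ∈ Icc t₀ t₁) : IntervalIntegrable v volume s t :=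
  (h.continuousOn_velocity.mono (uIcc_subset_Icc hs ht)).intervalIntegrable

theorem integral_control (h : IsTrajectory t₀ t₁ p v u) {s t : ℝ}
    (hs : s ∈ Icc t₀ t₁) (ht : t ∈ Icc t₀ t₁) : ∫ r in s..t, u r = v t - v s := by
  have h0 : t₀ ∈ Icc t₀ t₁ := ⟨le_rfl, hs.1.trans hs.2⟩
  rw [h.vel t ht, h.vel s hs, add_sub_add_left_eq_sub,
    intervalIntegral.integral_interval_sub_left (h.intervalIntegrable_control h0 ht)
      (h.intervalIntegrable_control h0 hs)]

theorem integral_velocity (h : IsTrajectory t₀ t₁ p v u) {s t : ℝ}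
    (hs : s ∈ Icc t₀ t₁) (ht : t ∈ Icc t₀ t₁) : ∫ r in s..t, v r = p t - p s := by
  have h0 : t₀ ∈ Icc t₀ t₁ := ⟨le_rfl, hs.1.trans hs.2⟩
  rw [h.pos t ht, h.pos s hs, add_sub_add_left_eq_sub,
    intervalIntegral.integral_interval_sub_left (h.intervalIntegrable_velocity h0 ht)
      (h.intervalIntegrable_velocity h0 hs)]

theorem add (h : IsTrajectory t₀ t₁ p v u) (h' : IsTrajectory t₀ t₁ q y ω) :
    IsTrajectory t₀ t₁ (p + q) (v + y) (u + ω) where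
  memLp := h.memLp.add h'.memLp
  vel t ht := by
    have h0 : t₀ ∈ Icc t₀ t₁ := ⟨le_rfl, ht.1.trans ht.2⟩
    simp only [Pi.add_apply]
    rw [intervalIntegral.integral_add (h.intervalIntegrable_control h0 ht)
      (h'.intervalIntegrable_control h0 ht), h.vel t ht, h'.vel t ht]
    abel
  pos t ht := by
    have h0 : t₀ ∈ Icc t₀ t₁ := ⟨le_rfl, ht.1.trans ht.2⟩
    simp only [Pi.add_apply]
    rw [intervalIntegral.integral_add (h.intervalIntegrable_velocity h0 ht)
      (h'.intervalIntegrable_velocity h0 ht), h.pos t ht, h'.pos t ht]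
    abel

theorem sub (h : IsTrajectory t₀ t₁ p v u) (h' : IsTrajectory t₀ t₁ q y ω) :
    IsTrajectory t₀ t₁ (p - q) (v - y) (u - ω) where
  memLp := h.memLp.sub h'.memLp
  vel t ht := by
    have h0 : t₀ ∈ Icc t₀ t₁ := ⟨le_rfl, ht.1.trans ht.2⟩
    simp only [Pi.sub_apply]
    rw [intervalIntegral.integral_sub (h.intervalIntegrable_control h0 ht)
      (h'.intervalIntegrable_control h0 ht), h.vel t ht, h'.vel t ht]
    abel
  pos t ht := by
    have h0 : t₀ ∈ Icc t₀ t₁ := ⟨le_rfl, ht.1.trans ht.2⟩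
    simp only [Pi.sub_apply]
    rw [intervalIntegral.integral_sub (h.intervalIntegrable_velocity h0 ht)
      (h'.intervalIntegrable_velocity h0 ht), h.pos t ht, h'.pos t ht]
    abel

/-- A smooth scalar function times a constant vector is a trajectory. -/
theorem of_contDiff {φ : ℝ → ℝ} (hφ : ContDiff ℝ 2 φ) (d : Plane) :
    IsTrajectory t₀ t₁ (fun t => φ t • d) (fun t => deriv φ t • d)
      (fun t => deriv (deriv φ) t • d) := by
  have h1 : ContDiff ℝ 1 (deriv φ) := hφ.deriv' (n := 1)
  have h2 : Continuous (deriv (deriv φ)) := h1.continuous_deriv le_rfl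
  refine ⟨?_, fun t _ => ?_, fun t _ => ?_⟩
  · have hc : Continuous fun t => deriv (deriv φ) t • d := h2.smul continuous_const
    exact (memLp_two_iff_integrable_sq_norm hc.aestronglyMeasurable).2
      ((hc.norm.pow 2).continuousOn.integrableOn_compact isCompact_Icc)
  · rw [intervalIntegral.integral_eq_sub_of_hasDerivAt
      (fun s _ => ((h1.differentiable one_ne_zero s).hasDerivAt.smul_const d))
      ((h2.smul continuous_const).intervalIntegrable _ _)]
    abel
  · rw [intervalIntegral.integral_eq_sub_of_hasDerivAt
      (fun s _ => ((hφ.differentiable two_ne_zero s).hasDerivAt.smul_const d))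
      ((h1.continuous.smul continuous_const).intervalIntegrable _ _)]
    abel

theorem integrable_sq_norm (h : IsTrajectory t₀ t₁ p v u) :
    IntegrableOn (fun t => ‖u t‖ ^ 2) (Icc t₀ t₁) :=
  (memLp_two_iff_integrable_sq_norm h.memLp.1).1 h.memLp

theorem intervalIntegrable_sq_norm (h : IsTrajectory t₀ t₁ p v u) {s t : ℝ}
    (hs : s ∈ Icc t₀ t₁) (ht : t ∈ Icc t₀ t₁) :
    IntervalIntegrable (fun t => ‖u t‖ ^ 2) volume s t :=
  (h.integrable_sq_norm.mono_set (uIcc_subset_Icc hs ht)).intervalIntegrable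

/-- Polarization reduces this to the square integrability of `u`, `ω` and `u + ω`. -/
theorem intervalIntegrable_inner (h : IsTrajectory t₀ t₁ p v u) (h' : IsTrajectory t₀ t₁ q y ω)
    {s t : ℝ} (hs : s ∈ Icc t₀ t₁) (ht : t ∈ Icc t₀ t₁) :
    IntervalIntegrable (fun t => (inner ℝ (u t) (ω t) : ℝ)) volume s t := by
  have := (((h.add h').intervalIntegrable_sq_norm hs ht).sub
    ((h.intervalIntegrable_sq_norm hs ht).add (h'.intervalIntegrable_sq_norm hs ht))).const_mul
      (1 / 2)
  refine this.congr fun r _ => ?_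
  simp only [Pi.add_apply]
  rw [norm_add_sq_real]
  ring

/-- The control vanishes almost everywhere on an interval on which the velocity vanishes. -/
theorem control_ae_eq_zero (h : IsTrajectory t₀ t₁ p v u) {c d : ℝ} (hc : c ∈ Icc t₀ t₁)
    (hd : d ∈ Icc t₀ t₁) (hcd : c ≤ d) (hv : ∀ t ∈ Icc c d, v t = 0) :
    ∀ᵐ t, t ∈ uIoc c d → u t = 0 := by
  -- Discarding `d` puts `t` in the open interval, near which the primitive of `u` is constant;
  -- Lebesgue differentiation does the rest.
  have hne : ∀ᵐ t : ℝ, t ≠ d := by simp [ae_iff, measure_singleton]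
  filter_upwards [(h.intervalIntegrable_control hc hd).ae_hasDerivAt_integral, hne]
    with t ht htd htm
  rw [uIoc_of_le hcd] at htm
  have h1 := ht (by rw [uIcc_of_le hcd]; exact ⟨htm.1.le, htm.2⟩) c left_mem_uIcc
  have h2 : (fun x => ∫ s in c..x, u s) =ᶠ[𝓝 t] fun _ => 0 := by
    filter_upwards [Ioo_mem_nhds htm.1 (lt_of_le_of_ne htm.2 htd)] with x hx
    rw [h.integral_control hc ⟨hc.1.trans hx.1.le, hx.2.le.trans hd.2⟩,
      hv x ⟨hx.1.le, hx.2.le⟩, hv c ⟨le_rfl, hcd⟩, sub_zero]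
  exact (h1.congr_of_eventuallyEq h2.symm).unique (hasDerivAt_const t 0)

end IsTrajectory

/-! ### Integration by parts against an affine control -/

/-- Both boundary terms vanish: `t - c` at `c`, the primitive at `e`. Since `f` is merely
integrable, the parts formula is the one for absolutely continuous functions. -/
theorem integral_sub_mul_eq_neg_integral_primitive {f : ℝ → ℝ} {e c : ℝ}
    (hf : IntervalIntegrable f volume e c) :
    ∫ t in e..c, (t - c) * f t = -∫ t in e..c, ∫ s in e..t, f s := by
  have hF := hf.absolutelyContinuousOnInterval_intervalIntegral (c := e) left_mem_uIcc
  have hg : AbsolutelyContinuousOnInterval (fun t : ℝ => t - c) e c :=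
    LipschitzOnWith.absolutelyContinuousOnInterval (K := 1)
      (LipschitzWith.of_dist_le_mul fun x y => by simp).lipschitzOnWith
  have key := hg.integral_mul_deriv_eq_deriv_mul hF
  simp only [sub_self, zero_mul, intervalIntegral.integral_same, mul_zero, zero_sub] at key
  have hd : ∀ t : ℝ, deriv (fun t : ℝ => t - c) t = 1 := fun t => by simp
  simp only [hd, one_mul] at key
  rw [← key]
  refine intervalIntegral.integral_congr_ae ?_
  filter_upwards [hf.ae_hasDerivAt_integral] with t ht htm
  rw [(ht (uIoc_subset_uIcc htm) e left_mem_uIcc).deriv]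

/-- The end points `e` and `τ` are unordered, so one formula serves the left arc (`e = a`) and the
right arc (`e = b`). -/
theorem IsTrajectory.integral_inner_affine {t₀ t₁ : ℝ} {u ξ η δ : ℝ → Plane}
    (h : IsTrajectory t₀ t₁ ξ η δ) {e τ : ℝ} (he : e ∈ Icc t₀ t₁) (hτ : τ ∈ Icc t₀ t₁)
    (hξ : ξ e = 0) (hη : η e = 0) {u₀ m : Plane}
    (hu : ∀ t ∈ uIoo e τ, u t = u₀ + (t - τ) • m) :
    ∫ t in e..τ, (inner ℝ (u t) (δ t) : ℝ) = inner ℝ u₀ (η τ) - inner ℝ m (ξ τ) := by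
  have hδ := h.intervalIntegrable_control he hτ
  have hin : ∀ x : Plane, IntervalIntegrable (fun t => (inner ℝ x (δ t) : ℝ)) volume e τ :=
    fun x => ⟨hδ.1.const_inner x, hδ.2.const_inner x⟩
  have hint : ∀ (x : Plane) {f : ℝ → Plane} {t : ℝ}, IntervalIntegrable f volume e t →
      ∫ s in e..t, (inner ℝ x (f s) : ℝ) = inner ℝ x (∫ s in e..t, f s) := fun x f t hf =>
    (innerSL ℝ x).intervalIntegral_comp_comm hf
  have h1 : ∫ t in e..τ, (inner ℝ (u t) (δ t) : ℝ) =
      ∫ t in e..τ, ((inner ℝ u₀ (δ t) : ℝ) + (t - τ) * inner ℝ m (δ t)) := by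
    refine intervalIntegral.integral_congr_uIoo fun t ht => ?_
    simp only [hu t ht, inner_add_left, real_inner_smul_left]
  have h2 : IntervalIntegrable (fun t => (t - τ) * (inner ℝ m (δ t) : ℝ)) volume e τ :=
    (hin m).continuousOn_mul (by fun_prop)
  have h3 : ∫ t in e..τ, ∫ s in e..t, (inner ℝ m (δ s) : ℝ) = ∫ t in e..τ, inner ℝ m (η t) := by
    refine intervalIntegral.integral_congr fun t ht => ?_
    have ht' : t ∈ Icc t₀ t₁ := uIcc_subset_Icc he hτ ht
    rw [hint m (h.intervalIntegrable_control he ht'), h.integral_control he ht', hη, sub_zero]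
  rw [h1, intervalIntegral.integral_add (hin u₀) h2,
    integral_sub_mul_eq_neg_integral_primitive (hin m), h3, hint u₀ hδ,
    hint m (h.intervalIntegrable_velocity he hτ), h.integral_control he hτ,
    h.integral_velocity he hτ, hξ, hη, sub_zero, sub_zero, sub_eq_add_neg]

/-! ### The energy of a competitor -/

/-- The contributions `u₀ · η(τ)` of the two arcs cancel because `u` has the same limit on both
sides; only the jump of the slope survives. Outside `(a, b)` the velocity `η` vanishes, hence so
does `δ` almost everywhere. -/
theorem energy_add {t₀ t₁ a τ b : ℝ} (h₀ : t₀ ≤ a) (ha : a < τ) (hb : τ < b) (h₁ : b ≤ t₁)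
    {p v u ξ η δ : ℝ → Plane} (h : IsTrajectory t₀ t₁ p v u) (h' : IsTrajectory t₀ t₁ ξ η δ)
    (hzero : ∀ t ∈ Icc t₀ t₁ \ Ioo a b, ξ t = 0 ∧ η t = 0) {u₀ wl wr : Plane}
    (hl : ∀ t ∈ Ioo a τ, u t = u₀ + (t - τ) • wl) (hr : ∀ t ∈ Ioo τ b, u t = u₀ + (t - τ) • wr) :
    energy t₀ t₁ (u + δ) =
      energy t₀ t₁ u + inner ℝ (wr - wl) (ξ τ) + (1 / 2) * ∫ t in a..b, ‖δ t‖ ^ 2 := by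
  have m0 : t₀ ∈ Icc t₀ t₁ := ⟨le_rfl, by linarith⟩
  have ma : a ∈ Icc t₀ t₁ := ⟨h₀, by linarith⟩
  have mτ : τ ∈ Icc t₀ t₁ := ⟨by linarith, by linarith⟩
  have mb : b ∈ Icc t₀ t₁ := ⟨by linarith, h₁⟩
  have m1 : t₁ ∈ Icc t₀ t₁ := ⟨by linarith, le_rfl⟩
  have za := hzero a ⟨ma, fun x => lt_irrefl _ x.1⟩
  have zb := hzero b ⟨mb, fun x => lt_irrefl _ x.2⟩
  have el := h'.integral_inner_affine (u := u) ma mτ za.1 za.2 (u₀ := u₀) (m := wl)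
    (by rw [uIoo_of_le ha.le]; exact hl)
  have er := h'.integral_inner_affine (u := u) mb mτ zb.1 zb.2 (u₀ := u₀) (m := wr)
    (by rw [uIoo_of_ge hb.le]; exact hr)
  set F : ℝ → ℝ := fun t => 2 * inner ℝ (u t) (δ t) + ‖δ t‖ ^ 2 with hF
  have iI : ∀ {s t : ℝ}, s ∈ Icc t₀ t₁ → t ∈ Icc t₀ t₁ →
      IntervalIntegrable (fun t => (inner ℝ (u t) (δ t) : ℝ)) volume s t := fun hs ht =>
    h.intervalIntegrable_inner h' hs ht
  have iF : ∀ {s t : ℝ}, s ∈ Icc t₀ t₁ → t ∈ Icc t₀ t₁ → IntervalIntegrable F volume s t :=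
    fun hs ht => ((iI hs ht).const_mul 2).add (h'.intervalIntegrable_sq_norm hs ht)
  have z0 : ∫ t in t₀..a, F t = 0 := by
    refine intervalIntegral.integral_zero_ae ?_
    filter_upwards [h'.control_ae_eq_zero m0 ma h₀ fun t ht =>
      (hzero t ⟨⟨ht.1, ht.2.trans ma.2⟩, fun x => absurd x.1 (not_lt.2 ht.2)⟩).2] with t ht hm
    simp [hF, ht hm]
  have z1 : ∫ t in b..t₁, F t = 0 := by
    refine intervalIntegral.integral_zero_ae ?_
    filter_upwards [h'.control_ae_eq_zero mb m1 h₁ fun t ht =>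
      (hzero t ⟨⟨mb.1.trans ht.1, ht.2⟩, fun x => absurd x.2 (not_lt.2 ht.1)⟩).2] with t ht hm
    simp [hF, ht hm]
  have e1 : ∫ t in t₀..t₁, ‖(u + δ) t‖ ^ 2 = (∫ t in t₀..t₁, ‖u t‖ ^ 2) + ∫ t in t₀..t₁, F t := by
    rw [← intervalIntegral.integral_add (h.intervalIntegrable_sq_norm m0 m1) (iF m0 m1)]
    refine intervalIntegral.integral_congr fun t _ => ?_
    simp only [hF, Pi.add_apply]
    rw [norm_add_sq_real]
    ring
  have e2 : ∫ t in t₀..t₁, F t = ∫ t in a..b, F t := by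
    rw [← intervalIntegral.integral_add_adjacent_intervals (iF m0 ma) (iF ma m1), z0,
      ← intervalIntegral.integral_add_adjacent_intervals (iF ma mb) (iF mb m1), z1]
    simp
  have e3 : ∫ t in a..b, F t = 2 * (∫ t in a..b, (inner ℝ (u t) (δ t) : ℝ)) +
      ∫ t in a..b, ‖δ t‖ ^ 2 := by
    rw [← intervalIntegral.integral_const_mul,
      ← intervalIntegral.integral_add ((iI ma mb).const_mul 2)
        (h'.intervalIntegrable_sq_norm ma mb)]
  have e4 : ∫ t in a..b, (inner ℝ (u t) (δ t) : ℝ) = inner ℝ (wr - wl) (ξ τ) := by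
    rw [← intervalIntegral.integral_add_adjacent_intervals (iI ma mτ) (iI mτ mb), el,
      intervalIntegral.integral_symm, er, inner_sub_left]
    ring
  simp only [energy]
  rw [e1, e2, e3, e4]
  ring

/-! ### Unconstrained arcs -/

/-- The filter is left general to cover limits at either end of the arc. -/
theorem eq_of_hasDerivAt_zero_of_tendsto {f : ℝ → Plane} {x y : ℝ} {l : Filter ℝ} [l.NeBot]
    {L : Plane} (hf : ∀ t ∈ Ioo x y, HasDerivAt f 0 t) (hl : Ioo x y ∈ l)
    (hL : Tendsto f l (𝓝 L)) : ∀ t ∈ Ioo x y, f t = L := fun t ht => by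
  have hc : ∀ s ∈ Ioo x y, f s = f t := fun s hs =>
    isOpen_Ioo.is_const_of_deriv_eq_zero isPreconnected_Ioo
      (fun r hr => (hf r hr).differentiableAt.differentiableWithinAt)
      (fun r hr => (hf r hr).deriv) hs ht
  refine tendsto_nhds_unique ((tendsto_const_nhds (x := f t)).congr' ?_) hL
  filter_upwards [hl] with s hs using (hc s hs).symm

/-- On an unconstrained arc the control is affine, determined by the limits of the control and of
its derivative at an end point. -/
theorem IsUnconstrainedArc.eq_affine {x y τ : ℝ} {u w : ℝ → Plane} (h : IsUnconstrainedArc x y u w)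
    {l : Filter ℝ} [l.NeBot] (hl : Ioo x y ∈ l) (hτ : l ≤ 𝓝 τ) {u₀ m : Plane}
    (hu : Tendsto u l (𝓝 u₀)) (hw : Tendsto w l (𝓝 m)) :
    ∀ t ∈ Ioo x y, w t = m ∧ u t = u₀ + (t - τ) • m := by
  have hwm := eq_of_hasDerivAt_zero_of_tendsto (fun t ht => (h t ht).2) hl hw
  -- Once `w` is known to be the constant `m`, subtracting the linear part leaves a function with
  -- zero derivative.
  have hum := eq_of_hasDerivAt_zero_of_tendsto (f := fun t => u t - (t - τ) • m) (l := l) (L := u₀)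
    (x := x) (y := y) (fun t ht => by
      convert! (h t ht).1.sub (((hasDerivAt_id t).sub_const τ).smul_const m) using 1
      rw [hwm t ht, one_smul, sub_self]) hl (by
      have h1 : Tendsto (fun t : ℝ => (t - τ) • m) l (𝓝 ((τ - τ) • m)) :=
        (((continuous_id.sub continuous_const).smul continuous_const).tendsto τ).mono_left hτ
      simpa using hu.sub h1)
  exact fun t ht => ⟨hwm t ht, by rw [← hum t ht]; abel⟩

/-! ### First-order conditions -/

theorem hamiltonian_zero_multipliers (O : Environment) (nrm : O.Face → Plane)
    (q y ω lp lv : Plane) :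
    hamiltonian O nrm q y ω lp lv (fun _ => 0) =
      (1 / 2) * ‖ω‖ ^ 2 + inner ℝ y lp + inner ℝ ω lv := by
  simp [hamiltonian]

theorem gradient_hamiltonian_position (O : Environment) (nrm : O.Face → Plane)
    (q y ω lp lv : Plane) (μ : O.Face → ℝ) :
    gradient (fun q => hamiltonian O nrm q y ω lp lv μ) q = 0 :=
  (hasGradientAt_const q (hamiltonian O nrm 0 y ω lp lv μ)).gradient

theorem gradient_hamiltonian_velocity (O : Environment) (nrm : O.Face → Plane)
    (q y ω lp lv : Plane) (μ : O.Face → ℝ) :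
    gradient (fun y => hamiltonian O nrm q y ω lp lv μ) y = lp := by
  refine HasGradientAt.gradient ?_
  rw [hasGradientAt_iff_hasFDerivAt]
  have h1 : HasFDerivAt (fun y : Plane => (inner ℝ lp y : ℝ))
      (InnerProductSpace.toDual ℝ Plane lp) y :=
    (InnerProductSpace.toDual ℝ Plane lp).hasFDerivAt
  simp only [hamiltonian]
  exact (((h1.congr_of_eventuallyEq (Eventually.of_forall fun z => real_inner_comm _ _)).const_add
    _).add_const _).sub_const _

/-- Completing the square: the difference of the two sides is `½‖ω - u‖²`. -/
theorem hamiltonian_neg_le (O : Environment) (nrm : O.Face → Plane) (q y u ω lp : Plane) :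
    hamiltonian O nrm q y u lp (-u) (fun _ => 0) ≤
      hamiltonian O nrm q y ω lp (-u) (fun _ => 0) := by
  simp only [hamiltonian_zero_multipliers, inner_neg_right, real_inner_self_eq_norm_sq]
  have := norm_sub_sq_real ω u
  nlinarith [sq_nonneg ‖ω - u‖]

theorem satisfiesOptimalityConditions_of_affine (O : Environment) (nrm : O.Face → Plane)
    {a τ b : ℝ} (j : O.Face) {p v u : ℝ → Plane} (ha : a < τ) (hb : τ < b)
    (hv : ContinuousAt v τ) {u₀ wl wr : Plane}
    (hl : ∀ t ∈ Ioo a τ, u t = u₀ + (t - τ) • wl) (hr : ∀ t ∈ Ioo τ b, u t = u₀ + (t - τ) • wr)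
    (horth : inner ℝ (wl - wr) (v τ) = 0) :
    SatisfiesOptimalityConditions O nrm a τ b j p v u := by
  have nl : Ioo a τ ∈ 𝓝[<] τ := Ioo_mem_nhdsLT ha
  have nr : Ioo τ b ∈ 𝓝[>] τ := Ioo_mem_nhdsGT hb
  -- The position costate is the slope of `u`; its value at `τ` itself plays no role.
  set lp : ℝ → Plane := fun t => if t < τ then wl else wr with hlp
  have lpl : ∀ t ∈ Ioo a τ, lp t = wl := fun t ht => if_pos ht.2
  have lpr : ∀ t ∈ Ioo τ b, lp t = wr := fun t ht => if_neg ht.1.not_gt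
  have affine_tendsto : ∀ (m : Plane) (s : Set ℝ),
      Tendsto (fun t : ℝ => u₀ + (t - τ) • m) (𝓝[s] τ) (𝓝 u₀) := fun m s => by
    have : Continuous fun t : ℝ => u₀ + (t - τ) • m := by fun_prop
    simpa using (this.tendsto τ).mono_left nhdsWithin_le_nhds
  have affine_deriv : ∀ (m : Plane) (t : ℝ),
      HasDerivAt (fun t : ℝ => u₀ + (t - τ) • m) m t := fun m t => by
    simpa using (((hasDerivAt_id t).sub_const τ).smul_const m).const_add u₀
  have ul : Tendsto u (𝓝[<] τ) (𝓝 u₀) := (affine_tendsto wl _).congr' (by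
    filter_upwards [nl] with t ht using (hl t ht).symm)
  have ur : Tendsto u (𝓝[>] τ) (𝓝 u₀) := (affine_tendsto wr _).congr' (by
    filter_upwards [nr] with t ht using (hr t ht).symm)
  have tl : Tendsto lp (𝓝[<] τ) (𝓝 wl) := tendsto_const_nhds.congr' (by
    filter_upwards [nl] with t ht using (lpl t ht).symm)
  have tr : Tendsto lp (𝓝[>] τ) (𝓝 wr) := tendsto_const_nhds.congr' (by
    filter_upwards [nr] with t ht using (lpr t ht).symm)
  have locally_affine : ∀ t ∈ Ioo a τ ∪ Ioo τ b, HasDerivAt lp 0 t ∧ HasDerivAt u (lp t) t := by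
    rintro t (ht | ht)
    · have hn := Ioo_mem_nhds ht.1 ht.2
      refine ⟨(hasDerivAt_const t wl).congr_of_eventuallyEq ?_, ?_⟩
      · filter_upwards [hn] with s hs using lpl s hs
      · rw [lpl t ht]
        refine (affine_deriv wl t).congr_of_eventuallyEq ?_
        filter_upwards [hn] with s hs using hl s hs
    · have hn := Ioo_mem_nhds ht.1 ht.2
      refine ⟨(hasDerivAt_const t wr).congr_of_eventuallyEq ?_, ?_⟩
      · filter_upwards [hn] with s hs using lpr s hs
      · rw [lpr t ht]
        refine (affine_deriv wr t).congr_of_eventuallyEq ?_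
        filter_upwards [hn] with s hs using hr s hs
  refine ⟨lp, -u, fun _ _ => 0, wl - wr, wl, wr, -u₀, -u₀, fun t ht => ⟨?_, ?_, ?_, ?_⟩,
    tl, tr, ul.neg, ur.neg, ?_, ?_, ?_⟩
  · rw [gradient_hamiltonian_position, neg_zero]
    exact (locally_affine t ht).1
  · rw [gradient_hamiltonian_velocity]
    exact (locally_affine t ht).2.neg
  · exact fun k => ⟨le_rfl, fun _ => rfl⟩
  · exact fun ω => hamiltonian_neg_le O nrm _ _ _ ω _
  · rw [fderiv_sub_const, fderiv_fun_id, ContinuousLinearMap.adjoint_id]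
    simp
  · simp
  · have hlim : ∀ {l : Filter ℝ} {m : Plane}, l ≤ 𝓝 τ → Tendsto u l (𝓝 u₀) →
        Tendsto lp l (𝓝 m) → Tendsto (fun t => hamiltonian O nrm (p t) (v t) (u t) (lp t) ((-u) t)
          (fun _ => 0)) l (𝓝 ((1 / 2) * ‖u₀‖ ^ 2 + inner ℝ (v τ) m + inner ℝ u₀ (-u₀))) := by
      intro l m hl' hu' hm
      simp only [hamiltonian_zero_multipliers, Pi.neg_apply]
      exact (((hu'.norm.pow 2).const_mul _).add ((hv.tendsto.mono_left hl').inner hm)).add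
        (hu'.inner hu'.neg)
    refine ⟨_, hlim nhdsWithin_le_nhds ul tl, ?_⟩
    -- Only the term `v · λᵖ` of the Hamiltonian can jump, and orthogonality rules that out.
    have heq : (inner ℝ (v τ) wl : ℝ) = inner ℝ (v τ) wr := by
      rw [inner_sub_left, sub_eq_zero] at horth
      rwa [real_inner_comm, real_inner_comm wr]
    rw [heq]
    exact hlim nhdsWithin_le_nhds ur tr

/-! ### The least energy as a function of the contact time -/

section Junction

variable {t₀ t₁ a τ b : ℝ} {p v u : ℝ → Plane} {u₀ wl wr : Plane}

/-- The slope of `u` breaks at `τ`, but the deviation is prescribed at `s`. Moving from `τ` to `s`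
changes it by at most `|s - τ| ∫‖δ‖`, and Young's inequality absorbs the resulting error into
`½∫‖δ‖²` at a cost quadratic in `s - τ`. -/
theorem energy_ge_of_isCompetitor (h₀ : t₀ ≤ a) (ha : a < τ) (hb : τ < b) (h₁ : b ≤ t₁)
    (h : IsTrajectory t₀ t₁ p v u) (hl : ∀ t ∈ Ioo a τ, u t = u₀ + (t - τ) • wl)
    (hr : ∀ t ∈ Ioo τ b, u t = u₀ + (t - τ) • wr) {s : ℝ} (hs : s ∈ Ioo a b)
    {q y ω : ℝ → Plane} {c : Plane} (hc : IsCompetitor t₀ t₁ a b p v c s q y ω) :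
    energy t₀ t₁ u + inner ℝ (wr - wl) (c - p s) -
      (1 / 2) * ((b - a) * ‖wr - wl‖ ^ 2) * (s - τ) ^ 2 ≤ energy t₀ t₁ ω := by
  have hab : a ≤ b := (ha.trans hb).le
  have ma : a ∈ Icc t₀ t₁ := ⟨h₀, hab.trans h₁⟩
  have mb : b ∈ Icc t₀ t₁ := ⟨h₀.trans hab, h₁⟩
  have mem : ∀ {t : ℝ}, t ∈ Icc a b → t ∈ Icc t₀ t₁ :=
    fun ht => ⟨h₀.trans ht.1, ht.2.trans h₁⟩
  have hτ : τ ∈ Icc a b := ⟨ha.le, hb.le⟩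
  have hs' : s ∈ Icc a b := Ioo_subset_Icc_self hs
  have hd := hc.1.sub h
  have hz : ∀ t ∈ Icc t₀ t₁ \ Ioo a b, (q - p) t = 0 ∧ (y - v) t = 0 := fun t ht =>
    ⟨sub_eq_zero.2 (hc.2.1 t ht).1, sub_eq_zero.2 (hc.2.1 t ht).2⟩
  have he := energy_add h₀ ha hb h₁ h hd hz hl hr
  rw [add_sub_cancel] at he
  set δ : ℝ → Plane := ω - u with hδ
  have iδ := hd.intervalIntegrable_control ma mb
  set A := ∫ t in a..b, ‖δ t‖ with hA
  have hη : ∀ t ∈ Icc a b, ‖(y - v) t‖ ≤ A := fun t ht => by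
    have h2 := hd.integral_control ma (mem ht)
    rw [(hz a ⟨ma, fun x => lt_irrefl _ x.1⟩).2, sub_zero] at h2
    rw [← h2]
    exact (intervalIntegral.norm_integral_le_integral_norm ht.1).trans
      (intervalIntegral.integral_mono_interval le_rfl ht.1 ht.2
        (Eventually.of_forall fun _ => norm_nonneg _) iδ.norm)
  have hξ : ‖(q - p) s - (q - p) τ‖ ≤ A * |s - τ| := by
    rw [← hd.integral_velocity (mem hτ) (mem hs')]
    exact intervalIntegral.norm_integral_le_of_norm_le_const fun t ht =>
      hη t (uIcc_subset_Icc hτ hs' (uIoc_subset_uIcc ht))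
  have hin : inner ℝ (wr - wl) (c - p s) - ‖wr - wl‖ * (A * |s - τ|) ≤
      (inner ℝ (wr - wl) ((q - p) τ) : ℝ) := by
    have h3 := real_inner_le_norm (wr - wl) ((q - p) s - (q - p) τ)
    have h4 := mul_le_mul_of_nonneg_left hξ (norm_nonneg (wr - wl))
    rw [inner_sub_right] at h3
    have h5 : (q - p) s = c - p s := by rw [Pi.sub_apply, hc.2.2]
    rw [h5] at h3 h4
    linarith
  have hamgm : ‖wr - wl‖ * (A * |s - τ|) ≤ (1 / 2) * (∫ t in a..b, ‖δ t‖ ^ 2) +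
      (1 / 2) * ((b - a) * ‖wr - wl‖ ^ 2) * (s - τ) ^ 2 := by
    have h6 : ∫ t in a..b, (‖wr - wl‖ * |s - τ|) * ‖δ t‖ ≤
        ∫ t in a..b, ((1 / 2) * ‖δ t‖ ^ 2 + (1 / 2) * (‖wr - wl‖ * |s - τ|) ^ 2) := by
      refine intervalIntegral.integral_mono_on hab (iδ.norm.const_mul _)
        (((hd.intervalIntegrable_sq_norm ma mb).const_mul _).add intervalIntegrable_const)
        fun t _ => ?_
      nlinarith [sq_nonneg (‖wr - wl‖ * |s - τ| - ‖δ t‖)]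
    rw [intervalIntegral.integral_const_mul, intervalIntegral.integral_add
      ((hd.intervalIntegrable_sq_norm ma mb).const_mul _) intervalIntegrable_const,
      intervalIntegral.integral_const_mul, intervalIntegral.integral_const, smul_eq_mul,
      mul_pow, sq_abs] at h6
    linarith
  rw [he]
  linarith

/-- Add `φ • (c - p s)` with a bump `φ` equal to `1` near `τ`: the deviation is then the same at `s`
and at `τ`. The constant `C = ½∫ (φ'')²` depends neither on `c` nor on `s`. -/
theorem exists_isCompetitor (h₀ : t₀ ≤ a) (ha : a < τ) (hb : τ < b) (h₁ : b ≤ t₁)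
    (h : IsTrajectory t₀ t₁ p v u) (hl : ∀ t ∈ Ioo a τ, u t = u₀ + (t - τ) • wl)
    (hr : ∀ t ∈ Ioo τ b, u t = u₀ + (t - τ) • wr) :
    ∃ C : ℝ, ∀ c : Plane, ∀ᶠ s in 𝓝 τ, ∃ q y ω, IsCompetitor t₀ t₁ a b p v c s q y ω ∧
      energy t₀ t₁ ω = energy t₀ t₁ u + inner ℝ (wr - wl) (c - p s) + C * ‖c - p s‖ ^ 2 := by
  obtain ⟨r, hr0, hra, hrb⟩ : ∃ r, 0 < r ∧ a < τ - r ∧ τ + r < b := by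
    have h1 : 0 < min (τ - a) (b - τ) := lt_min (sub_pos.2 ha) (sub_pos.2 hb)
    refine ⟨min (τ - a) (b - τ) / 2, half_pos h1, ?_, ?_⟩
    · linarith [min_le_left (τ - a) (b - τ)]
    · linarith [min_le_right (τ - a) (b - τ)]
  let φ : ContDiffBump τ := ⟨r / 2, r, half_pos hr0, half_lt_self hr0⟩
  have hsupp : tsupport φ ⊆ Ioo a b := by
    rw [φ.tsupport_eq, Real.closedBall_eq_Icc]
    exact Icc_subset_Ioo hra hrb
  -- The derivative must vanish too, since competitors keep the velocity outside `(a, b)`.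
  have hφ0 : ∀ t, t ∉ Ioo a b → φ t = 0 ∧ deriv φ t = 0 := fun t ht =>
    ⟨image_eq_zero_of_notMem_tsupport fun hm => ht (hsupp hm),
      image_eq_zero_of_notMem_tsupport fun hm => ht (hsupp (tsupport_deriv_subset hm))⟩
  refine ⟨(1 / 2) * ∫ t in a..b, (deriv (deriv φ) t) ^ 2, fun c => ?_⟩
  filter_upwards [φ.eventuallyEq_one] with s hs
  have hφs : φ s = 1 := hs
  have hφτ : φ τ = 1 := φ.eventuallyEq_one.eq_of_nhds
  have hd := IsTrajectory.of_contDiff (t₀ := t₀) (t₁ := t₁) (φ := φ) φ.contDiff (c - p s)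
  refine ⟨_, _, _, ⟨h.add hd, fun t ht => ?_, ?_⟩, ?_⟩
  · simp [hφ0 t ht.2]
  · simp [hφs]
  · rw [energy_add h₀ ha hb h₁ h hd (fun t ht => by simp [hφ0 t ht.2]) hl hr]
    simp only [hφτ, one_smul, norm_smul, mul_pow, intervalIntegral.integral_mul_const,
      Real.norm_eq_abs, sq_abs, mul_assoc]

/-- A first-order Taylor estimate: `u` is bounded on both arcs, and its uncontrolled value at `τ`
does not affect the integrals. -/
theorem exists_norm_position_sub_le (h₀ : t₀ ≤ a) (ha : a < τ) (hb : τ < b) (h₁ : b ≤ t₁)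
    (h : IsTrajectory t₀ t₁ p v u) (hl : ∀ t ∈ Ioo a τ, u t = u₀ + (t - τ) • wl)
    (hr : ∀ t ∈ Ioo τ b, u t = u₀ + (t - τ) • wr) :
    ∃ B : ℝ, 0 ≤ B ∧ ∀ s ∈ Ioo a b, ‖p s - p τ - (s - τ) • v τ‖ ≤ B * (s - τ) ^ 2 := by
  have mem : ∀ {t : ℝ}, t ∈ Ioo a b → t ∈ Icc t₀ t₁ :=
    fun ht => ⟨h₀.trans ht.1.le, ht.2.le.trans h₁⟩
  have hτ : τ ∈ Ioo a b := ⟨ha, hb⟩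
  set B := ‖u₀‖ + (b - a) * (‖wl‖ + ‖wr‖) with hB
  have hB0 : 0 ≤ B := by
    have : 0 ≤ b - a := by linarith
    positivity
  have hbound : ∀ (t : ℝ) (m : Plane), t ∈ Ioo a b → ‖m‖ ≤ ‖wl‖ + ‖wr‖ →
      ‖u₀ + (t - τ) • m‖ ≤ B := fun t m ht hm => by
    refine (norm_add_le _ _).trans (add_le_add_right ?_ _)
    rw [norm_smul]
    refine mul_le_mul ?_ hm (norm_nonneg _) (by linarith)
    rw [Real.norm_eq_abs, abs_le]
    constructor <;> linarith [ht.1, ht.2]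
  have hu : ∀ t ∈ Ioo a b, t ≠ τ → ‖u t‖ ≤ B := fun t ht hne => by
    rcases lt_or_gt_of_ne hne with hlt | hlt
    · rw [hl t ⟨ht.1, hlt⟩]
      exact hbound t _ ht (le_add_of_nonneg_right (norm_nonneg _))
    · rw [hr t ⟨hlt, ht.2⟩]
      exact hbound t _ ht (le_add_of_nonneg_left (norm_nonneg _))
  have hne : ∀ᵐ t : ℝ, t ≠ τ := by simp [ae_iff, measure_singleton]
  have hsub : ∀ {s t : ℝ}, s ∈ Ioo a b → t ∈ uIoc τ s → t ∈ Ioo a b := fun hs ht =>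
    ordConnected_Ioo.uIcc_subset hτ hs (uIoc_subset_uIcc ht)
  have hv : ∀ t ∈ Ioo a b, ‖v t - v τ‖ ≤ B * |t - τ| := fun t ht => by
    rw [← h.integral_control (mem hτ) (mem ht)]
    refine intervalIntegral.norm_integral_le_of_norm_le_const_ae ?_
    filter_upwards [hne] with r hr' hm using hu r (hsub ht hm) hr'
  refine ⟨B, hB0, fun s hs => ?_⟩
  have hint : ∫ t in τ..s, (v t - v τ) = p s - p τ - (s - τ) • v τ := by
    rw [intervalIntegral.integral_sub (h.intervalIntegrable_velocity (mem hτ) (mem hs))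
      intervalIntegrable_const, h.integral_velocity (mem hτ) (mem hs),
      intervalIntegral.integral_const]
  rw [← hint, ← sq_abs, pow_two, ← mul_assoc]
  refine intervalIntegral.norm_integral_le_of_norm_le_const fun t ht => ?_
  refine (hv t (hsub hs ht)).trans (mul_le_mul_of_nonneg_left ?_ hB0)
  exact abs_sub_left_of_mem_uIcc (uIoc_subset_uIcc ht)

theorem isLeast_contactEnergies (h₀ : t₀ ≤ a) (ha : a < τ) (hb : τ < b) (h₁ : b ≤ t₁)
    (h : IsTrajectory t₀ t₁ p v u) (hl : ∀ t ∈ Ioo a τ, u t = u₀ + (t - τ) • wl)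
    (hr : ∀ t ∈ Ioo τ b, u t = u₀ + (t - τ) • wr) :
    IsLeast (contactEnergies t₀ t₁ a b p v (p τ) τ) (energy t₀ t₁ u) := by
  refine ⟨⟨p, v, u, ⟨h, fun _ _ => ⟨rfl, rfl⟩, rfl⟩, rfl⟩, ?_⟩
  rintro _ ⟨q, y, ω, hc, rfl⟩
  simpa using energy_ge_of_isCompetitor h₀ ha hb h₁ h hl hr ⟨ha, hb⟩ hc

theorem hasDerivAt_sInf_contactEnergies (h₀ : t₀ ≤ a) (ha : a < τ) (hb : τ < b) (h₁ : b ≤ t₁)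
    (h : IsTrajectory t₀ t₁ p v u) (hl : ∀ t ∈ Ioo a τ, u t = u₀ + (t - τ) • wl)
    (hr : ∀ t ∈ Ioo τ b, u t = u₀ + (t - τ) • wr) (horth : inner ℝ (wl - wr) (v τ) = 0) :
    HasDerivAt (fun s => sInf (contactEnergies t₀ t₁ a b p v (p τ) s)) 0 τ := by
  obtain ⟨C, hC⟩ := exists_isCompetitor h₀ ha hb h₁ h hl hr
  obtain ⟨B, hB0, hB⟩ := exists_norm_position_sub_le h₀ ha hb h₁ h hl hr
  have hWτ := (isLeast_contactEnergies h₀ ha hb h₁ h hl hr).csInf_eq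
  set W : ℝ → ℝ := fun s => sInf (contactEnergies t₀ t₁ a b p v (p τ) s) with hW
  set E := energy t₀ t₁ u
  set K := ‖wr - wl‖ with hK
  set D := ‖v τ‖ + B * (b - a) with hD
  have horth' : inner ℝ (wr - wl) (v τ) = (0 : ℝ) := by
    rw [← neg_sub wl wr, inner_neg_left, horth, neg_zero]
  have hlin : ∀ s ∈ Ioo a b, |(inner ℝ (wr - wl) (p τ - p s) : ℝ)| ≤ K * B * (s - τ) ^ 2 := by
    intro s hs
    have h1 : (inner ℝ (wr - wl) (p τ - p s) : ℝ) =
        -inner ℝ (wr - wl) (p s - p τ - (s - τ) • v τ) := by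
      simp only [inner_sub_right, real_inner_smul_right] at horth' ⊢
      rw [horth']
      ring
    rw [h1, abs_neg, mul_assoc]
    exact (abs_real_inner_le_norm _ _).trans
      (mul_le_mul_of_nonneg_left (hB s hs) (norm_nonneg _))
  have hdist : ∀ s ∈ Ioo a b, ‖p τ - p s‖ ^ 2 ≤ D ^ 2 * (s - τ) ^ 2 := by
    intro s hs
    have h1 : p s - p τ = (p s - p τ - (s - τ) • v τ) + (s - τ) • v τ := by abel
    have h2 : |s - τ| ≤ b - a := by
      rw [abs_le]
      constructor <;> linarith [hs.1, hs.2]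
    have h3 : ‖p τ - p s‖ ≤ D * |s - τ| := by
      rw [norm_sub_rev, h1]
      refine (norm_add_le _ _).trans ?_
      rw [norm_smul, Real.norm_eq_abs]
      have h4 := hB s hs
      rw [← sq_abs] at h4
      nlinarith [mul_le_mul_of_nonneg_left h2 (mul_nonneg hB0 (abs_nonneg (s - τ)))]
    rw [← sq_abs (s - τ), ← mul_pow]
    exact pow_le_pow_left₀ (norm_nonneg _) h3 2
  -- The exponent `2 > 1` is what forces the derivative to be zero. The three constants below come
  -- from the Taylor remainder, the bump and Young's inequality.
  have hO : (fun s => W s - E) =O[𝓝 τ] fun s => ‖s - τ‖ ^ 2 := by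
    refine Asymptotics.IsBigO.of_bound
      (K * B + |C| * D ^ 2 + (1 / 2) * ((b - a) * K ^ 2)) ?_
    filter_upwards [hC (p τ), Ioo_mem_nhds ha hb] with s ⟨q, y, ω, hc, heω⟩ hs
    have hlower : ∀ J ∈ contactEnergies t₀ t₁ a b p v (p τ) s,
        E + inner ℝ (wr - wl) (p τ - p s) -
          (1 / 2) * ((b - a) * K ^ 2) * (s - τ) ^ 2 ≤ J := by
      rintro _ ⟨q', y', ω', hc', rfl⟩
      exact energy_ge_of_isCompetitor h₀ ha hb h₁ h hl hr hs hc'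
    have hmem : energy t₀ t₁ ω ∈ contactEnergies t₀ t₁ a b p v (p τ) s := ⟨q, y, ω, hc, rfl⟩
    -- The lower bound and the explicit competitor also make the set bounded below and nonempty, so
    -- that `sInf` is a genuine infimum.
    have hle : W s ≤ energy t₀ t₁ ω := csInf_le ⟨_, hlower⟩ hmem
    have hge := le_csInf ⟨_, hmem⟩ hlower
    have hi := abs_le.1 (hlin s hs)
    have hq : C * ‖p τ - p s‖ ^ 2 ≤ |C| * (D ^ 2 * (s - τ) ^ 2) :=
      mul_le_mul (le_abs_self C) (hdist s hs) (sq_nonneg _) (abs_nonneg C)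
    have hpos : 0 ≤ (1 / 2) * ((b - a) * K ^ 2) * (s - τ) ^ 2 := by
      have : 0 ≤ b - a := by linarith
      positivity
    have hpos' : 0 ≤ |C| * (D ^ 2 * (s - τ) ^ 2) := by positivity
    rw [norm_pow, norm_norm, Real.norm_eq_abs, Real.norm_eq_abs, sq_abs, abs_le]
    rw [heω] at hle
    constructor <;> linarith [hi.1, hi.2]
  have hder := (hO.hasFDerivAt one_lt_two).hasDerivAt.add_const E
  simpa using hder

end Junction

theorem lemma2 (O : Environment) (nrm : O.Face → Plane)
    (hnrm : ∀ k, O.IsOutwardNormal k (nrm k))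
    (t₀ t₁ a τ b : ℝ) (h₀ : t₀ ≤ a) (ha : a < τ) (hb : τ < b) (h₁ : b ≤ t₁)
    (x₀ x₁ : Plane × Plane) (p v u w : ℝ → Plane)
    (hfeas : IsFeasible O t₀ t₁ x₀ x₁ p v u)
    (j : O.Face) (htouch : TouchesInstantaneously O a b τ j p)
    (hleft : IsUnconstrainedArc a τ u w) (hright : IsUnconstrainedArc τ b u w)
    (hjunction : JunctionConditions p v u w τ (O.corner j)) :
    IsOptimalAtJunction O nrm t₀ t₁ a τ b x₀ x₁ j p v u := by
  obtain ⟨hpτ, -, ⟨u₀, hul, hur⟩, wl, wr, hwl, hwr, horth⟩ := hjunction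
  have h := hfeas.trajectory
  have hl : ∀ t ∈ Ioo a τ, u t = u₀ + (t - τ) • wl := fun t ht =>
    (hleft.eq_affine (Ioo_mem_nhdsLT ha) nhdsWithin_le_nhds hul hwl t ht).2
  have hr : ∀ t ∈ Ioo τ b, u t = u₀ + (t - τ) • wr := fun t ht =>
    (hright.eq_affine (Ioo_mem_nhdsGT hb) nhdsWithin_le_nhds hur hwr t ht).2
  have hv : ContinuousAt v τ :=
    h.continuousOn_velocity.continuousAt
      (Icc_mem_nhds (h₀.trans_lt ha) (hb.trans_le h₁))
  have hleast := isLeast_contactEnergies h₀ ha hb h₁ h hl hr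
  have hstat := hasDerivAt_sInf_contactEnergies h₀ ha hb h₁ h hl hr horth
  rw [hpτ] at hleast hstat
  refine ⟨satisfiesOptimalityConditions_of_affine O nrm j ha hb hv hl hr horth, hleast,
    ⟨⟨p, v, u, hfeas, ⟨h, fun _ _ => ⟨rfl, rfl⟩, hpτ⟩, rfl⟩, ?_⟩, hstat⟩
  -- Obstacle avoidance only shrinks the set of competitors, so the unconstrained minimum still
  -- bounds it.
  rintro _ ⟨q, y, ω, -, hc, rfl⟩
  exact hleast.2 ⟨q, y, ω, hc, rfl⟩
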